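/- Nonexistence of $(7,1,3)$-functions. Let $f:\mathbb{F}_2^n\to\mathbb{F}_2$ be a Boolean function of $n$ variables. For $x\in\mathbb{F}_2^n$ and $S\subseteq[n]$ let $x^{(S)}$ be the point $x$ with the bits in $S$ flipped, and $x^i=x^{(\{i\})}$. The sensitivity of $f$ is $s(f)=\max_{x}|\{i\in[n]: f(x)\neq f(x^i)\}|$. The function $f$ is $k$-th order sensitive if there is a point $x$ such that $f(x)\ne f(x^{(S)})$ for all $S\subseteq[n]$ with $1\le|S|\le k$. The real polynomial degree $\mathrm{pdeg}(f)$ is the total degree of the unique multilinear real polynomial in $n$ variables that agrees with $f$ (with values read as the real numbers $0,1$) on $\{0,1\}^n$. An $(n,k,p)$-function is a Boolean function of $n$ variables that is $k$-th order sensitive and has $\mathrm{pdeg}(f)\le p$. Then: 1. there is no $(7,1,3)$-function; 2. in particular, there is no Boolean function $f$ of $7$ variables with full sensitivity $s(f)=7$ and $\mathrm{pdeg}(f)=3$; 3. for every candidate sensitive point $x\in\mathbb{F}_2^7$ the following integer program is infeasible: find integers $(y_v)_{v\in\mathbb{F}_2^7}$ with $y_v\in\{0,1\}$ for all $v$, $y_x=0$,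 $y_{x^i}=1$ for $1\le i\le 7$, and $$\sum_{v\in\mathbb{F}_2^7}(1-2y_v)(-1)^{u\cdot v}=0\qquad\text{for all }u\in\mathbb{F}_2^7\text{ of Hamming weight at least }4.$$ -/

import Mathlib

open Finset MvPolynomial

/-- A Boolean function of `n` variables, `f : 𝔽₂ⁿ → 𝔽₂`. -/
abbrev BoolFun (n : ℕ) : Type := (Fin n → ZMod 2) → ZMod 2

/-- `x^(S)`: the point `x` with the bits in `S` flipped. -/
def flipBits {n : ℕ} (x : Fin n → ZMod 2) (S : Finset (Fin n)) : Fin n → ZMod 2 :=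
  fun i => if i ∈ S then x i + 1 else x i

/-- `s(f, x)`: the number of bits of `x` whose flipping changes the value of `f`. -/
def sensitivityAt {n : ℕ} (f : BoolFun n) (x : Fin n → ZMod 2) : ℕ :=
  #{i : Fin n | f x ≠ f (flipBits x {i})}

/-- `s(f)`: the maximum of `s(f, x)` over all points `x`. -/
def sensitivity {n : ℕ} (f : BoolFun n) : ℕ :=
  (univ : Finset (Fin n → ZMod 2)).sup (sensitivityAt f)

/-- `f` is `k`-th order sensitive: at some point `x`, flipping any `i` bits with
`1 ≤ i ≤ k` changes the value of `f`. -/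
def IsOrderSensitive {n : ℕ} (k : ℕ) (f : BoolFun n) : Prop :=
  ∃ x : Fin n → ZMod 2, ∀ S : Finset (Fin n), 1 ≤ #S → #S ≤ k → f x ≠ f (flipBits x S)

/-- The multilinear real polynomial that takes the values of `f`, read as the real
numbers `0` and `1`, on `{0,1}ⁿ`. -/
noncomputable def realPoly {n : ℕ} (f : BoolFun n) : MvPolynomial (Fin n) ℝ :=
  ∑ x : Fin n → ZMod 2, C ((f x).val : ℝ) * ∏ i : Fin n, (if x i = 1 then X i else 1 - X i)

/-- The polynomial `realPoly f` represents `f`. -/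
theorem eval_realPoly {n : ℕ} (f : BoolFun n) (x : Fin n → ZMod 2) :
    eval (fun i => ((x i).val : ℝ)) (realPoly f) = ((f x).val : ℝ) := by
  have h01 : ∀ a : ZMod 2, a = 0 ∨ a = 1 := by decide
  have key : ∀ y : Fin n → ZMod 2,
      ∏ i : Fin n, eval (fun i => ((x i).val : ℝ))
        (if y i = 1 then X i else 1 - X i : MvPolynomial (Fin n) ℝ) = if y = x then 1 else 0 := by
    intro y
    split_ifs with h
    · subst h
      refine prod_eq_one fun i _ => ?_
      rcases h01 (y i) with h | h <;> simp [h, -ZMod.natCast_val, ZMod.val_one]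
    · obtain ⟨i, hi⟩ := Function.ne_iff.mp h
      refine prod_eq_zero (mem_univ i) ?_
      rcases h01 (y i) with h | h <;> rcases h01 (x i) with h' | h' <;>
        simp_all [-ZMod.natCast_val, ZMod.val_one]
  simp only [realPoly, map_sum, map_mul, eval_C, map_prod, key]
  simp

/-- The polynomial `realPoly f` is multilinear, hence it is the only multilinear real
polynomial that represents `f`. -/
theorem degreeOf_realPoly_le {n : ℕ} (f : BoolFun n) (j : Fin n) :
    degreeOf j (realPoly f) ≤ 1 := by
  refine (degreeOf_sum_le j _ _).trans (Finset.sup_le fun x _ => ?_)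
  refine (degreeOf_C_mul_le _ j _).trans ((degreeOf_prod_le j _ _).trans ?_)
  have h : ∀ i : Fin n, degreeOf j (if x i = 1 then X i else 1 - X i : MvPolynomial (Fin n) ℝ)
      ≤ if j = i then 1 else 0 := by
    intro i
    have hX : degreeOf j (X i : MvPolynomial (Fin n) ℝ) = if j = i then 1 else 0 :=
      degreeOf_X j i
    split_ifs with h1 h2 h2
    · simp [h2]
    · rw [hX, if_neg h2]
    · refine (degreeOf_sub_le j _ _).trans ?_
      rw [hX, if_pos h2, degreeOf_one]; simp
    · refine (degreeOf_sub_le j _ _).trans ?_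
      rw [hX, if_neg h2, degreeOf_one]; simp
  exact (sum_le_sum fun i _ => h i).trans (by simp)

/-- `pdeg(f)`: the real polynomial degree of `f`. -/
noncomputable def pdeg {n : ℕ} (f : BoolFun n) : ℕ := (realPoly f).totalDegree

/-- An `(n,k,p)`-function: a Boolean function of `n` variables that is `k`-th order
sensitive and has real polynomial degree at most `p`. -/
def IsNKPFunction (n k p : ℕ) (f : BoolFun n) : Prop :=
  IsOrderSensitive k f ∧ pdeg f ≤ p

/-- `y : 𝔽₂ⁿ → ℤ` is a feasible point of the integer program attached to the candidate
sensitive point `x` and the degree bound `p`: the variables `y v` are binary, `y` is `0` at `x`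
and `1` at all neighbours of `x`, and the Walsh sums of `y` at all `u` of Hamming weight
greater than `p` vanish. -/
def IsFeasible {n : ℕ} (p : ℕ) (x : Fin n → ZMod 2) (y : (Fin n → ZMod 2) → ℤ) : Prop :=
  (∀ v, y v = 0 ∨ y v = 1) ∧
  y x = 0 ∧
  (∀ i : Fin n, y (flipBits x {i}) = 1) ∧
  ∀ u : Fin n → ZMod 2, p + 1 ≤ hammingNorm u →
    ∑ v : Fin n → ZMod 2, (1 - 2 * y v) * (-1) ^ (u ⬝ᵥ v).val = 0

/-! Averaging over spheres about `x` reduces the problem to one variable. If the Walsh sums of `g =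
1 - 2y` vanish above weight 3, the mean `a k` of `g` over the sphere of radius `k` is a polynomial
in `k` of degree at most 3; `sum_sphereSum_eq_sum_walshLevel` encodes this. Here `a 0 = 1`, `a 1 =
-1` and `|a k| ≤ 1`, which no such cubic satisfies. A sensitive point of a function of degree at
most 3 gives such a `y` by `isFeasible_of_pdeg_le`. -/

/-- The characters of `𝔽₂ⁿ` factor over the coordinates. -/
theorem neg_one_pow_val_sum {R ι : Type*} [CommRing R] (s : Finset ι) (a : ι → ZMod 2) :
    (-1 : R) ^ (∑ i ∈ s, a i).val = ∏ i ∈ s, (-1 : R) ^ (a i).val := by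
  classical
  have hadd : ∀ a b : ZMod 2, (-1 : R) ^ (a + b).val = (-1) ^ a.val * (-1) ^ b.val := by
    intro a b
    have h : ∀ a b : ZMod 2, (a + b).val % 2 = (a.val + b.val) % 2 := by decide
    rw [← pow_add, neg_one_pow_eq_pow_mod_two, h, ← neg_one_pow_eq_pow_mod_two]
  induction s using Finset.induction_on with
  | empty => simp
  | insert i s hi ih => rw [sum_insert hi, prod_insert hi, hadd, ih]

theorem sum_zmod_two {R : Type*} [AddCommMonoid R] (h : ZMod 2 → R) : ∑ a, h a = h 0 + h 1 :=
  Fin.sum_univ_two h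

/-- A product function sums to a product. -/
theorem sum_prod_pi_zmod_two {R : Type*} [CommRing R] {n : ℕ} (h : Fin n → ZMod 2 → R) :
    ∑ v : Fin n → ZMod 2, ∏ i, h i (v i) = ∏ i, (h i 0 + h i 1) := by
  simp_rw [← sum_zmod_two, prod_univ_sum, Fintype.piFinset_univ]

/-- A monomial of degree less than the weight of `u` is orthogonal to the character of `u`. -/
theorem sum_monomial_mul_character {n : ℕ} (u : Fin n → ZMod 2) (m : Fin n → ℕ)
    (hm : ∑ i, m i < hammingNorm u) :
    ∑ v : Fin n → ZMod 2, (∏ i, ((v i).val : ℝ) ^ m i) * (-1) ^ (u ⬝ᵥ v).val = 0 := by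
  -- A coordinate in the support of `u` but absent from the monomial contributes the factor `1 +
  -- (-1) = 0`.
  obtain ⟨i, hu, hi⟩ : ∃ i, u i ≠ 0 ∧ m i = 0 := by
    by_contra! h
    refine hm.not_ge ?_
    rw [hammingNorm, card_eq_sum_ones]
    refine (sum_le_sum fun i hi => ?_).trans (sum_le_sum_of_subset (subset_univ _))
    exact Nat.one_le_iff_ne_zero.mpr (h i (mem_filter.mp hi).2)
  have hu1 : u i = 1 := (by decide : ∀ a : ZMod 2, a ≠ 0 → a = 1) _ hu
  simp_rw [dotProduct, neg_one_pow_val_sum, ← prod_mul_distrib]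
  rw [sum_prod_pi_zmod_two fun i a => ((a.val : ℝ) ^ m i * (-1) ^ (u i * a).val)]
  refine prod_eq_zero (mem_univ i) ?_
  simp [hi, hu1, ZMod.val_one]

/-- The Walsh sums of a Boolean function vanish at all `u` of weight above the degree. -/
theorem walsh_eq_zero_of_pdeg_lt {n : ℕ} (f : BoolFun n) (u : Fin n → ZMod 2)
    (hu : pdeg f < hammingNorm u) :
    ∑ v : Fin n → ZMod 2, (1 - 2 * ((f v).val : ℤ)) * (-1) ^ (u ⬝ᵥ v).val = 0 := by
  have h1 : ∑ v : Fin n → ZMod 2, (-1 : ℝ) ^ (u ⬝ᵥ v).val = 0 := by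
    simpa using sum_monomial_mul_character u 0 (by simpa using (Nat.zero_le _).trans_lt hu)
  have h2 : ∑ v : Fin n → ZMod 2, ((f v).val : ℝ) * (-1 : ℝ) ^ (u ⬝ᵥ v).val = 0 := by
    simp_rw [← eval_realPoly f, eval_eq', sum_mul, mul_assoc]
    rw [sum_comm]
    refine sum_eq_zero fun m hm => ?_
    rw [← mul_sum, sum_monomial_mul_character u m, mul_zero]
    refine lt_of_le_of_lt ?_ hu
    have := le_totalDegree hm
    rwa [Finsupp.sum_fintype _ _ fun _ => rfl] at this
  have h3 : ∑ v : Fin n → ZMod 2, (1 - 2 * ((f v).val : ℝ)) * (-1) ^ (u ⬝ᵥ v).val = 0 := by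
    simp_rw [sub_mul, one_mul, mul_assoc, sum_sub_distrib, ← mul_sum]
    rw [h1, h2]; simp
  exact_mod_cast h3

/-- A fully sensitive point of a function of degree at most `p` yields a feasible point of the
integer program. -/
theorem isFeasible_of_pdeg_le {n p : ℕ} (f : BoolFun n) (x : Fin n → ZMod 2) (hp : pdeg f ≤ p)
    (hx : ∀ i, f x ≠ f (flipBits x {i})) :
    IsFeasible p x fun v => (((f v).val : ℤ) - (f x).val) ^ 2 := by
  refine ⟨fun v => ?_, by simp, fun i => ?_, fun u hu => ?_⟩
  · exact (by decide : ∀ a b : ZMod 2, ((a.val : ℤ) - b.val) ^ 2 = 0 ∨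
      ((a.val : ℤ) - b.val) ^ 2 = 1) _ _
  · exact (by decide : ∀ a b : ZMod 2, b ≠ a → ((a.val : ℤ) - b.val) ^ 2 = 1) _ _ (hx i)
  -- The square is the XOR with `f x`, so passing from `f` to it only multiplies the Walsh sums by a
  -- global sign.
  · have hmul : ∀ a b : ZMod 2, 1 - 2 * ((a.val : ℤ) - b.val) ^ 2 =
        (1 - 2 * (b.val : ℤ)) * (1 - 2 * (a.val : ℤ)) := by decide
    simp_rw [hmul, mul_assoc, ← mul_sum]
    rw [walsh_eq_zero_of_pdeg_lt f u (by omega), mul_zero]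

/-- The weight enumerator of the characters at a point. -/
theorem sum_pow_hammingNorm_mul_character {n : ℕ} (t : ℤ) (w : Fin n → ZMod 2) :
    ∑ u : Fin n → ZMod 2, t ^ hammingNorm u * (-1) ^ (u ⬝ᵥ w).val =
      (1 - t) ^ hammingNorm w * (1 + t) ^ (n - hammingNorm w) := by
  have hpow : ∀ u : Fin n → ZMod 2, t ^ hammingNorm u = ∏ i, if u i ≠ 0 then t else 1 := by
    intro u
    rw [prod_ite, prod_const, prod_const_one, mul_one, hammingNorm]
  simp_rw [dotProduct, neg_one_pow_val_sum, hpow, ← prod_mul_distrib]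
  rw [sum_prod_pi_zmod_two fun i a => (if a ≠ 0 then t else 1) * (-1) ^ (a * w i).val]
  have hcoord : ∀ i, (if (0 : ZMod 2) ≠ 0 then t else 1) * (-1) ^ (0 * w i).val +
      (if (1 : ZMod 2) ≠ 0 then t else 1) * (-1) ^ (1 * w i).val =
      if w i ≠ 0 then 1 - t else 1 + t := by
    intro i
    rcases (by decide : ∀ a : ZMod 2, a = 0 ∨ a = 1) (w i) with h | h <;>
      simp [h, ZMod.val_one, sub_eq_add_neg]
  simp_rw [hcoord]
  rw [prod_ite, prod_const, prod_const, hammingNorm]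
  congr 2
  have := card_filter_add_card_filter_not (s := (univ : Finset (Fin n))) (fun i => w i ≠ 0)
  rw [card_univ, Fintype.card_fin] at this
  omega

/-- The sum of `g` over the sphere of radius `k` about `x`. -/
def sphereSum {n : ℕ} (g : (Fin n → ZMod 2) → ℤ) (x : Fin n → ZMod 2) (k : ℕ) : ℤ :=
  ∑ w : Fin n → ZMod 2 with hammingNorm w = k, g (x + w)

/-- The sum of the terms of weight `k` of the Walsh expansion of `g` at `x`. -/
def walshLevel {n : ℕ} (g : (Fin n → ZMod 2) → ℤ) (x : Fin n → ZMod 2) (k : ℕ) : ℤ :=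
  ∑ u : Fin n → ZMod 2 with hammingNorm u = k,
    (-1) ^ (u ⬝ᵥ x).val * ∑ v, g v * (-1) ^ (u ⬝ᵥ v).val

theorem sum_fiberwise_hammingNorm {n : ℕ} (c : ℕ → ℤ) (h : (Fin n → ZMod 2) → ℤ) :
    ∑ w, c (hammingNorm w) * h w =
      ∑ k ∈ range (n + 1), c k * ∑ w : Fin n → ZMod 2 with hammingNorm w = k, h w := by
  rw [← sum_fiberwise_of_maps_to (s := univ) (t := range (n + 1)) (g := hammingNorm)]
  · refine sum_congr rfl fun k _ => ?_
    rw [mul_sum]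
    refine sum_congr rfl fun w hw => ?_
    rw [(mem_filter.mp hw).2]
  · intro w _
    have : hammingNorm w ≤ n := by simpa using hammingNorm_le_card_fintype (x := w)
    exact mem_range.mpr (by omega)

/-- The MacWilliams identity relating sphere sums to Walsh levels. -/
theorem sum_sphereSum_eq_sum_walshLevel {n : ℕ} (g : (Fin n → ZMod 2) → ℤ) (x : Fin n → ZMod 2)
    (t : ℤ) :
    ∑ k ∈ range (n + 1), (1 - t) ^ k * (1 + t) ^ (n - k) * sphereSum g x k =
      ∑ k ∈ range (n + 1), t ^ k * walshLevel g x k := by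
  simp_rw [sphereSum, walshLevel]
  rw [← sum_fiberwise_hammingNorm (fun k => (1 - t) ^ k * (1 + t) ^ (n - k)),
    ← sum_fiberwise_hammingNorm (fun k => t ^ k)]
  simp_rw [← sum_pow_hammingNorm_mul_character, sum_mul, mul_sum]
  rw [sum_comm]
  refine sum_congr rfl fun u _ => ?_
  -- Recentre at `x` by substituting `v = x + w`.
  rw [← Equiv.sum_comp (Equiv.addLeft x) fun v =>
    t ^ hammingNorm u * ((-1) ^ (u ⬝ᵥ x).val * (g v * (-1) ^ (u ⬝ᵥ v).val))]
  refine sum_congr rfl fun w _ => ?_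
  have hw : u ⬝ᵥ w = u ⬝ᵥ x + u ⬝ᵥ (x + w) := by
    rw [dotProduct_add, ← add_assoc, CharTwo.add_self_eq_zero, zero_add]
  have hsplit : (-1 : ℤ) ^ (u ⬝ᵥ w).val =
      (-1) ^ (u ⬝ᵥ x).val * (-1) ^ (u ⬝ᵥ (x + w)).val := by
    rw [hw]
    simpa using neg_one_pow_val_sum (R := ℤ) univ ![u ⬝ᵥ x, u ⬝ᵥ (x + w)]
  rw [Equiv.coe_addLeft, hsplit]
  ring

theorem walshLevel_eq_zero {n p k : ℕ} {x : Fin n → ZMod 2} {y : (Fin n → ZMod 2) → ℤ}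
    (h : IsFeasible p x y) (hk : p + 1 ≤ k) : walshLevel (fun v => 1 - 2 * y v) x k = 0 := by
  refine sum_eq_zero fun u hu => ?_
  rw [h.2.2.2 u ((mem_filter.mp hu).2 ▸ hk), mul_zero]

theorem sphereSum_zero {n : ℕ} (g : (Fin n → ZMod 2) → ℤ) (x : Fin n → ZMod 2) :
    sphereSum g x 0 = g x := by
  simp [sphereSum, hammingNorm_eq_zero, filter_eq']

/-- The number of points of weight `k`. -/
theorem card_hammingNorm_eq (n k : ℕ) :
    #{w : Fin n → ZMod 2 | hammingNorm w = k} = n.choose k := by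
  have hsup : ∀ s : Finset (Fin n),
      (univ.filter fun i => (if i ∈ s then (1 : ZMod 2) else 0) ≠ 0) = s := by
    intro s; ext i; simp
  have hcard : #(powersetCard k (univ : Finset (Fin n))) = n.choose k := by simp
  rw [← hcard]
  refine card_nbij' (fun w => univ.filter fun i => w i ≠ 0) (fun s i => if i ∈ s then 1 else 0)
    ?_ ?_ ?_ ?_
  · intro w hw
    simpa [mem_powersetCard, hammingNorm] using hw
  · intro s hs
    have hs' := (mem_powersetCard.mp hs).2
    refine mem_filter.mpr ⟨mem_univ _, ?_⟩
    rw [hammingNorm, hsup, hs']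
  · intro w _
    funext i
    rcases (by decide : ∀ a : ZMod 2, a = 0 ∨ a = 1) (w i) with h | h <;> simp [h]
  · intro s _
    exact hsup s

theorem sphereSum_const {n : ℕ} (c : ℤ) (x : Fin n → ZMod 2) (k : ℕ) :
    sphereSum (fun _ => c) x k = n.choose k * c := by
  rw [sphereSum, sum_const, card_hammingNorm_eq, nsmul_eq_mul]

theorem sphereSum_le_sphereSum {n : ℕ} {g h : (Fin n → ZMod 2) → ℤ} (hgh : ∀ v, g v ≤ h v)
    (x : Fin n → ZMod 2) (k : ℕ) : sphereSum g x k ≤ sphereSum h x k :=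
  sum_le_sum fun _ _ => hgh _

theorem sphereSum_one {n : ℕ} {g : (Fin n → ZMod 2) → ℤ} {x : Fin n → ZMod 2} {c : ℤ}
    (h : ∀ i, g (flipBits x {i}) = c) : sphereSum g x 1 = n * c := by
  have hconst := sphereSum_const c x 1
  rw [Nat.choose_one_right] at hconst
  rw [← hconst]
  refine sum_congr rfl fun w hw => ?_
  obtain ⟨i, hi⟩ := card_eq_one.mp (mem_filter.mp hw).2
  rw [← h i]
  congr 1
  funext j
  have hj := Finset.ext_iff.mp hi j
  rw [mem_filter, mem_singleton] at hj
  rcases (by decide : ∀ a : ZMod 2, a = 0 ∨ a = 1) (w j) with h | h <;>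
    simp_all [flipBits]

theorem not_isFeasible_seven_three (x : Fin 7 → ZMod 2) (y : (Fin 7 → ZMod 2) → ℤ) :
    ¬ IsFeasible 3 x y := by
  intro h
  have hy : ∀ v, -1 ≤ 1 - 2 * y v ∧ 1 - 2 * y v ≤ 1 := fun v => by
    rcases h.1 v with h | h <;> simp [h]
  have hid := sum_sphereSum_eq_sum_walshLevel (fun v => 1 - 2 * y v) x
  simp only [sum_range_succ, sum_range_zero, walshLevel_eq_zero h (k := 4) (by norm_num),
    walshLevel_eq_zero h (k := 5) (by norm_num), walshLevel_eq_zero h (k := 6) (by norm_num),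
    walshLevel_eq_zero h (k := 7) (by norm_num), sphereSum_zero, h.2.1,
    sphereSum_one (g := fun v => 1 - 2 * y v) (x := x) (c := -1)
      fun i => by simp [h.2.2.1 i]] at hid
  -- The fourth divided difference of a cubic at 0, 1, 2, 4, 7 vanishes: `45 a₀ - 140 a₁ + 126 a₂ -
  -- 35 a₄ + 4 a₇ = 0`. The signs dictate which bounds are needed; they make the left side at least
  -- 20.
  have h2 := sphereSum_le_sphereSum (fun v => (hy v).1) x 2
  have h4 := sphereSum_le_sphereSum (fun v => (hy v).2) x 4
  have h7 := sphereSum_le_sphereSum (fun v => (hy v).1) x 7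
  rw [sphereSum_const] at h2 h4 h7
  norm_num [Nat.choose] at h2 h4 h7
  -- Both sides have degree at most 7 in `t`, so eight distinct values capture the whole identity.
  have e0 := hid 0
  have e1 := hid 1
  have e2 := hid (-1)
  have e3 := hid 2
  have e4 := hid (-2)
  have e5 := hid 3
  have e6 := hid (-3)
  have e7 := hid 4
  norm_num at e0 e1 e2 e3 e4 e5 e6 e7
  linarith

theorem mainTheorem7 :
    (¬ ∃ f : BoolFun 7, IsNKPFunction 7 1 3 f) ∧
    (¬ ∃ f : BoolFun 7, sensitivity f = 7 ∧ pdeg f = 3) ∧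
    (∀ x : Fin 7 → ZMod 2, ¬ ∃ y : (Fin 7 → ZMod 2) → ℤ, IsFeasible 3 x y) := by
  refine ⟨?_, ?_, fun x ⟨y, hy⟩ => not_isFeasible_seven_three x y hy⟩
  · rintro ⟨f, ⟨x, hx⟩, hp⟩
    exact not_isFeasible_seven_three x _
      (isFeasible_of_pdeg_le f x hp fun i => hx {i} (by simp) (by simp))
  · rintro ⟨f, hs, hp⟩
    obtain ⟨x, -, hx⟩ := exists_mem_eq_sup univ univ_nonempty (sensitivityAt f)
    have hcard : #{i : Fin 7 | f x ≠ f (flipBits x {i})} = #(univ : Finset (Fin 7)) := by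
      rw [card_univ, Fintype.card_fin]
      exact hx.symm.trans hs
    exact not_isFeasible_seven_three x _
      (isFeasible_of_pdeg_le f x hp.le fun i => card_filter_eq_iff.mp hcard i (mem_univ i))
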